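/- Graphs are finite directed graphs $G=(V,E)$ (loops allowed). The diameter of $G$ is the largest finite distance in $G$, i.e. the maximum of $\mathrm{dist}(u,v)$ over all pairs $u,v\in V$ such that $u$ can reach $v$. The co-liveness (co-Büchi) problem is: given $G$, a start vertex $s\in V$ and a set $T\subseteq V$, decide whether there is an infinite path in $G$ starting in $s$ that eventually visits only vertices of $T$. A symbolic algorithm knows $V$, $s$, $T$, and accesses the edges of $G$ only through the one-step operations $\mathrm{Pre}(S)=\{v\in V\mid \exists s'\in S:(v,s')\in E\}$ and $\mathrm{Post}(S)=\{v\in V\mid \exists s'\in S:(s',v)\in E\}$ for sets $S\subseteq V$ of its choice; all other computation (including basic set operations on vertex sets) and the storage of vertex sets are free and unrestricted. A randomized symbolic algorithm is a random choice of a (deterministic) symbolic algorithm. **Proposition 3.7.** Any deterministic or bounded-error randomized symbolic algorithm that solves co-liveness on graphs with diameter $D$ needs $\Omega(D)$ one-step operations. That is: 1. There is a constant $c>0$ such that for every $D\in\mathbb{N}$ and every deterministic symbolic algorithm that halts with the correct answer to the co-liveness problem on all inputs $(G,s,T)$ where $G$ has diameter $D$, there is an input $(G,s,T)$, where $G$ has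 diameter $D$, on which the algorithm performs at least $c\,D$ one-step operations. 2. For every $\varepsilon\in[0,1/2)$ there is a constant $c>0$ (depending only on $\varepsilon$) such that for every $D\in\mathbb{N}$ and every randomized symbolic algorithm that, on every input $(G,s,T)$ where $G$ has diameter $D$, halts with the correct answer to the co-liveness problem with probability at least $1-\varepsilon$, there is an input $(G,s,T)$, where $G$ has diameter $D$, on which the expected (hence also the worst-case) number of one-step operations performed is at least $c\,D$. -/

import Mathlib

open scoped NNReal ENNReal

/-! ## Directed graphs, distances, diameter, and the co-liveness objective -/

namespace Digraph

variable {V : Type}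

/-- `G.WalkOfLength m u v`: there is a walk from `u` to `v` in `G` with exactly `m` edges. -/
def WalkOfLength (G : Digraph V) : ℕ → V → V → Prop
  | 0, u, v => u = v
  | m + 1, u, v => ∃ w, G.Adj u w ∧ G.WalkOfLength m w v

/-- The distance from `u` to `v`: the least number of edges of a path from `u` to `v`, and `⊤` if
`u` cannot reach `v`. -/
noncomputable def distance (G : Digraph V) (u v : V) : ℕ∞ :=
  ⨅ (m : ℕ) (_ : G.WalkOfLength m u v), (m : ℕ∞)

/-- The diameter of `G`: the largest *finite* distance in `G`, that is, the supremum of the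
distances from `u` to `v` over all pairs such that `u` can reach `v`. -/
noncomputable def diameter (G : Digraph V) : ℕ∞ :=
  ⨆ (u : V) (v : V) (_ : G.distance u v ≠ ⊤), G.distance u v

/-- The co-liveness (co-Büchi) objective: some infinite path of `G` that starts in `s` eventually
visits only vertices of `T`. -/
def CoBuchi (G : Digraph V) (s : V) (T : Set V) : Prop :=
  ∃ p : ℕ → V, p 0 = s ∧ (∀ i, G.Adj (p i) (p (i + 1))) ∧ ∃ N, ∀ i, N ≤ i → p i ∈ T

/-- The one-step operation `Pre`: the vertices with an edge to some vertex of `S`. -/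
def preSet (G : Digraph V) (S : Set V) : Set V := {v | ∃ s ∈ S, G.Adj v s}

/-- The one-step operation `Post`: the vertices with an edge from some vertex of `S`. -/
def postSet (G : Digraph V) (S : Set V) : Set V := {v | ∃ s ∈ S, G.Adj s v}

end Digraph

/-! ## Symbolic algorithms -/

/-- The instructions of a symbolic machine with vertex set `V` and memory contents in `Mem`:
* `halt b`: stop with the answer `b`;
* `compute m`: continue with memory contents `m`.  This stands for every operation that does not
  access the edges of the graph: basic set operations (`∪`, `∩`, `\`, `⊆`, `=`) on vertex sets held
  in the memory, and the ordinary arithmetic, logical and memory operations;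
* `pre S k`: perform the one-step operation `Pre(S)` and continue with memory contents `k R`,
  where `R` is the resulting vertex set;
* `post S k`: the same for `Post(S)`. -/
inductive SymbolicInstr (V Mem : Type) : Type
  | halt (b : Bool)
  | compute (m : Mem)
  | pre (S : Set V) (k : Set V → Mem)
  | post (S : Set V) (k : Set V → Mem)

/-- A (deterministic) symbolic machine over the vertex set `V`: a set of memory contents (without
any bound on the number of vertex sets stored), the initial memory contents, and the next
instruction as a function of the memory contents.  The machine has no access to the edges of the
graph except through the results of `pre` and `post` instructions. -/
structure SymbolicMachine (V : Type) : Type 1 where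
  Mem : Type
  init : Mem
  instr : Mem → SymbolicInstr V Mem

namespace SymbolicMachine

variable {V : Type}

/-- The memory contents after executing one instruction on the graph `G`. -/
def step (M : SymbolicMachine V) (G : Digraph V) (m : M.Mem) : M.Mem :=
  match M.instr m with
  | .halt _ => m
  | .compute m' => m'
  | .pre S k => k (G.preSet S)
  | .post S k => k (G.postSet S)

/-- The memory contents after `t` instructions on the graph `G`. -/
def run (M : SymbolicMachine V) (G : Digraph V) : ℕ → M.Mem
  | 0 => M.init
  | t + 1 => M.step G (M.run G t)

/-- The number (`0` or `1`) of one-step operations in the instruction executed at memory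
contents `m`. -/
def stepCost (M : SymbolicMachine V) (m : M.Mem) : ℕ :=
  match M.instr m with
  | .halt _ => 0
  | .compute _ => 0
  | .pre _ _ => 1
  | .post _ _ => 1

/-- The total number of one-step operations performed in the run on `G` (it may be `⊤` if the
machine does not halt). -/
noncomputable def oneStepOps (M : SymbolicMachine V) (G : Digraph V) : ℕ∞ :=
  ⨆ t : ℕ, ((∑ i ∈ Finset.range t, M.stepCost (M.run G i) : ℕ) : ℕ∞)

/-- The machine halts on `G` with the answer `b`. -/
def Outputs (M : SymbolicMachine V) (G : Digraph V) (b : Bool) : Prop :=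
  ∃ t, M.instr (M.run G t) = .halt b

/-- The machine halts on `G` and decides correctly whether the co-liveness objective with start
vertex `s` and safe set `T` can be satisfied. -/
def CorrectCoBuchi (M : SymbolicMachine V) (G : Digraph V) (s : V) (T : Set V) : Prop :=
  ∃ b : Bool, M.Outputs G b ∧ (b = true ↔ G.CoBuchi s T)

end SymbolicMachine

/-- A deterministic symbolic algorithm for problems whose input is a finite directed graph (on the
vertex set `Fin n`) with a start vertex `s` and a vertex set `T`.  The number of vertices, `s` and
`T` are known to the algorithm from the start; the edges are not. -/
structure SymbolicAlgorithm : Type 1 where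
  machine : ∀ (n : ℕ), Fin n → Set (Fin n) → SymbolicMachine (Fin n)

/-- The algorithm solves co-liveness on all (finite directed) graphs of diameter `D`. -/
def SymbolicAlgorithm.SolvesCoBuchi (A : SymbolicAlgorithm) (D : ℕ) : Prop :=
  ∀ (n : ℕ) (G : Digraph (Fin n)) (s : Fin n) (T : Set (Fin n)), G.diameter = D →
    (A.machine n s T).CorrectCoBuchi G s T

/-- A randomized symbolic algorithm: a symbolic algorithm chosen at random, where the random choice
`ω` (for instance the sequence of all coin tosses) comes from an arbitrary probability space. -/
structure RandomizedSymbolicAlgorithm : Type 1 where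
  Ω : Type
  mΩ : MeasurableSpace Ω
  μ : MeasureTheory.Measure Ω
  isProb : MeasureTheory.IsProbabilityMeasure μ
  alg : Ω → SymbolicAlgorithm
  measurableSet_outputs : ∀ (n : ℕ) (G : Digraph (Fin n)) (s : Fin n) (T : Set (Fin n)) (b : Bool),
    MeasurableSet {ω | ((alg ω).machine n s T).Outputs G b}
  measurable_oneStepOps : ∀ (n : ℕ) (G : Digraph (Fin n)) (s : Fin n) (T : Set (Fin n)),
    Measurable fun ω => ((alg ω).machine n s T).oneStepOps G

namespace RandomizedSymbolicAlgorithm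

/-- The algorithm solves co-liveness on all (finite directed) graphs of diameter `D` with error
probability at most `ε`: on each such input it halts with the correct answer with probability
at least `1 - ε`. -/
def SolvesCoBuchi (A : RandomizedSymbolicAlgorithm) (ε : ℝ) (D : ℕ) : Prop :=
  ∀ (n : ℕ) (G : Digraph (Fin n)) (s : Fin n) (T : Set (Fin n)), G.diameter = D →
    ENNReal.ofReal (1 - ε) ≤ A.μ {ω | ((A.alg ω).machine n s T).CorrectCoBuchi G s T}

/-- The expected number of one-step operations that the algorithm performs on a given input. -/
noncomputable def expectedOneStepOps (A : RandomizedSymbolicAlgorithm) {n : ℕ}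
    (G : Digraph (Fin n)) (s : Fin n) (T : Set (Fin n)) : ℝ≥0∞ :=
  letI := A.mΩ
  ∫⁻ ω, (((A.alg ω).machine n s T).oneStepOps G : ℝ≥0∞) ∂A.μ

end RandomizedSymbolicAlgorithm

/-! An adversary argument: hide one loop in a graph where each one-step operation can reveal at most
one possible loop. The graph has vertices 0, …, D, all descending edges and the edges from each
vertex to its successor; T is the set of even vertices. Without loops an infinite path cannot stay
in T, since edges between even vertices descend; one loop at an even t makes the answer positive.
The diameter is D in every case. A loop at t changes Pre(S) only if t is the minimum of S, and
Post(S) only if t is the maximum: otherwise a descending edge already puts t into the result. So in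
the run on the loop-free graph, distinct even t must be ruled out by distinct operations
(`card_le_oneStepOps`), which gives at least D/2 of them. In the randomized case, each even t is
told apart from the loop-free graph with probability at least 1 - 2ε. Summing over t bounds the
expected cost. -/

namespace Digraph

/-- The graph on `0, …, D` with all edges to smaller vertices, all edges from a vertex to its
successor, and loops at the vertices of `X`. -/
def loopedLadder (D : ℕ) (X : Set (Fin (D + 1))) : Digraph (Fin (D + 1)) where
  Adj u v := v < u ∨ v.val = u.val + 1 ∨ (u = v ∧ u ∈ X)

variable {D : ℕ} {X : Set (Fin (D + 1))}

theorem loopedLadder_adj {u v : Fin (D + 1)} :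
    (loopedLadder D X).Adj u v ↔ v < u ∨ v.val = u.val + 1 ∨ (u = v ∧ u ∈ X) := Iff.rfl

theorem le_add_of_walkOfLength_loopedLadder {m : ℕ} {u v : Fin (D + 1)}
    (h : (loopedLadder D X).WalkOfLength m u v) : v.val ≤ u.val + m := by
  induction m generalizing u with
  | zero => exact (congrArg Fin.val (show u = v from h)).ge
  | succ m ih =>
    obtain ⟨w, hw, h⟩ := h
    have := ih h
    rcases loopedLadder_adj.1 hw with h1 | h1 | ⟨h1, -⟩
    · have : w.val < u.val := h1
      omega
    · omega
    · subst h1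
      omega

theorem walkOfLength_loopedLadder {m : ℕ} {u v : Fin (D + 1)} (h : v.val = u.val + m) :
    (loopedLadder D X).WalkOfLength m u v := by
  induction m generalizing u with
  | zero => exact Fin.ext (by omega)
  | succ m ih =>
    have hv := v.isLt
    exact ⟨⟨u.val + 1, by omega⟩, Or.inr (Or.inl rfl), ih (by simp only; omega)⟩

theorem distance_le {V : Type} {G : Digraph V} {m : ℕ} {u v : V} (h : G.WalkOfLength m u v) :
    G.distance u v ≤ m := iInf₂_le m h

theorem distance_loopedLadder_le (u v : Fin (D + 1)) : (loopedLadder D X).distance u v ≤ D := by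
  have hu := u.isLt
  have hv := v.isLt
  rcases lt_trichotomy u v with h | h | h
  · have h' : u.val < v.val := h
    refine (distance_le (walkOfLength_loopedLadder (m := v.val - u.val) (by omega))).trans ?_
    exact_mod_cast (by omega : v.val - u.val ≤ D)
  · exact (distance_le (m := 0) h).trans (by simp)
  · have h' : v.val < u.val := h
    refine (distance_le (m := 1) ⟨v, Or.inl h, rfl⟩).trans ?_
    exact_mod_cast (by omega : 1 ≤ D)

/-- An edge climbs by at most 1, so going from 0 to D takes D edges; descending takes one edge, and
loops shorten nothing. -/
theorem diameter_loopedLadder (D : ℕ) (X : Set (Fin (D + 1))) :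
    (loopedLadder D X).diameter = D := by
  apply le_antisymm
  · exact iSup_le fun u => iSup_le fun v => iSup_le fun _ => distance_loopedLadder_le u v
  · have hne : (loopedLadder D X).distance 0 (Fin.last D) ≠ ⊤ :=
      ne_top_of_le_ne_top (ENat.natCast_ne_top D) (distance_loopedLadder_le _ _)
    refine le_trans ?_ (le_iSup_of_le 0 (le_iSup_of_le (Fin.last D) (le_iSup_of_le hne le_rfl)))
    refine le_iInf₂ fun m hm => ?_
    have := le_add_of_walkOfLength_loopedLadder hm
    simp only [Fin.val_last, Fin.val_zero, zero_add] at this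
    exact_mod_cast this

theorem not_coBuchi_loopedLadder_empty (s : Fin (D + 1)) :
    ¬ (loopedLadder D ∅).CoBuchi s {v | Even v.val} := by
  rintro ⟨p, -, hp, N, hN⟩
  -- Successor edges change parity, so once the path stays in T only descending edges remain.
  have hlt : ∀ i, (p (N + (i + 1))).val < (p (N + i)).val := by
    intro i
    have h0 : Even (p (N + i)).val := hN _ (by omega)
    have h1 : Even (p (N + (i + 1))).val := hN _ (by omega)
    rcases loopedLadder_adj.1 (hp (N + i)) with h | h | h
    · exact h
    · rw [add_assoc] at h
      rw [h] at h1
      exact absurd h0 (Nat.even_add_one.1 h1)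
    · exact absurd h.2 (Set.notMem_empty _)
  have hanti : StrictAnti fun i => (p (N + i)).val := strictAnti_nat_of_succ_lt hlt
  exact WellFounded.not_rel_apply_succ (r := (· < · : ℕ → ℕ → Prop))
    (fun i => (p (N + i)).val) |>.elim fun i hi => hi (hlt i)

theorem coBuchi_loopedLadder_singleton {T : Set (Fin (D + 1))} {t : Fin (D + 1)} (ht : t ∈ T) :
    (loopedLadder D {t}).CoBuchi 0 T := by
  have hD := t.isLt
  -- The path climbs to t, then uses the loop forever.
  refine ⟨fun i => ⟨min i t.val, by omega⟩, by ext; simp, fun i => ?_, t.val, fun i hi => ?_⟩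
  · rcases lt_or_ge i t.val with h | h
    · exact Or.inr (Or.inl (by simp only; omega))
    · exact Or.inr (Or.inr ⟨Fin.ext (by simp only; omega),
        Set.mem_singleton_iff.2 (Fin.ext (by simp only; omega))⟩)
  · have : (⟨min i t.val, by omega⟩ : Fin (D + 1)) = t := Fin.ext (by simp only; omega)
    simpa only [this] using ht

/-- `Pre(S)` depends on the presence of a loop at `t` only if `t` is the least element of `S`. -/
theorem isLeast_of_preSet_loopedLadder_ne {S : Set (Fin (D + 1))} {t : Fin (D + 1)}
    (h : (loopedLadder D ∅).preSet S ≠ (loopedLadder D {t}).preSet S) : IsLeast S t := by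
  by_contra hS
  refine h (Set.ext fun v => ⟨?_, ?_⟩)
  · rintro ⟨s, hs, ha⟩
    exact ⟨s, hs, ha.imp_right (Or.imp_right fun h => absurd h.2 (Set.notMem_empty _))⟩
  · rintro ⟨s, hs, ha | ha | ⟨rfl, rfl⟩⟩
    · exact ⟨s, hs, Or.inl ha⟩
    · exact ⟨s, hs, Or.inr (Or.inl ha)⟩
    -- A smaller element of S makes the loop redundant: v has a descending edge to it.
    · have : ∃ s ∈ S, s < v := by
        by_contra! hle
        exact hS ⟨hs, hle⟩
      obtain ⟨s, hs, hlt⟩ := this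
      exact ⟨s, hs, Or.inl hlt⟩

/-- `Post(S)` depends on the presence of a loop at `t` only if `t` is the greatest element
of `S`. -/
theorem isGreatest_of_postSet_loopedLadder_ne {S : Set (Fin (D + 1))} {t : Fin (D + 1)}
    (h : (loopedLadder D ∅).postSet S ≠ (loopedLadder D {t}).postSet S) : IsGreatest S t := by
  by_contra hS
  refine h (Set.ext fun v => ⟨?_, ?_⟩)
  · rintro ⟨s, hs, ha⟩
    exact ⟨s, hs, ha.imp_right (Or.imp_right fun h => absurd h.2 (Set.notMem_empty _))⟩
  · rintro ⟨s, hs, ha | ha | ⟨rfl, rfl⟩⟩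
    · exact ⟨s, hs, Or.inl ha⟩
    · exact ⟨s, hs, Or.inr (Or.inl ha)⟩
    · have : ∃ u ∈ S, s < u := by
        by_contra! hle
        exact hS ⟨hs, hle⟩
      obtain ⟨u, hu, hlt⟩ := this
      exact ⟨u, hu, Or.inl hlt⟩

end Digraph

/-! ### Indistinguishable runs and the deterministic bound -/

namespace SymbolicMachine

variable {V : Type} {M : SymbolicMachine V} {G G' : Digraph V}

theorem run_eq_of_le_of_halt {b : Bool} {i j : ℕ} (h : M.instr (M.run G i) = .halt b)
    (hij : i ≤ j) : M.run G j = M.run G i := by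
  induction j, hij using Nat.le_induction with
  | base => rfl
  | succ j _ ih => rw [run, ih, step, h]

theorem Outputs.unique {b b' : Bool} (h : M.Outputs G b) (h' : M.Outputs G b') : b = b' := by
  obtain ⟨i, hi⟩ := h
  obtain ⟨j, hj⟩ := h'
  have h1 := run_eq_of_le_of_halt hi (le_max_left i j)
  have h2 := run_eq_of_le_of_halt hj (le_max_right i j)
  rw [← h1, h2, hj] at hi
  exact (SymbolicInstr.halt.inj hi).symm

/-- Agreement is needed only at the states visited on `G`, so the adversary can follow that single
run. -/
theorem run_eq_of_step_eq {n : ℕ}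
    (h : ∀ i < n, M.step G (M.run G i) = M.step G' (M.run G i)) : M.run G n = M.run G' n := by
  induction n with
  | zero => rfl
  | succ n ih =>
    rw [run, run, h n n.lt_succ_self, ih fun i hi => h i (hi.trans n.lt_succ_self)]

open Digraph

variable {D : ℕ} {M : SymbolicMachine (Fin (D + 1))}

theorem stepCost_eq_one_of_step_loopedLadder_ne {m : M.Mem} {t : Fin (D + 1)}
    (h : M.step (loopedLadder D ∅) m ≠ M.step (loopedLadder D {t}) m) : M.stepCost m = 1 := by
  unfold step at h
  unfold stepCost
  cases hm : M.instr m <;> simp_all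

/-- A single instruction can detect a loop at no more than one vertex. -/
theorem eq_of_step_loopedLadder_ne {m : M.Mem} {t u : Fin (D + 1)}
    (ht : M.step (loopedLadder D ∅) m ≠ M.step (loopedLadder D {t}) m)
    (hu : M.step (loopedLadder D ∅) m ≠ M.step (loopedLadder D {u}) m) : t = u := by
  unfold step at ht hu
  cases hm : M.instr m with
  | halt b => simp [hm] at ht
  | compute m' => simp [hm] at ht
  | pre S k =>
    simp only [hm] at ht hu
    exact (isLeast_of_preSet_loopedLadder_ne fun h => ht (congrArg k h)).unique
      (isLeast_of_preSet_loopedLadder_ne fun h => hu (congrArg k h))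
  | post S k =>
    simp only [hm] at ht hu
    exact (isGreatest_of_postSet_loopedLadder_ne fun h => ht (congrArg k h)).unique
      (isGreatest_of_postSet_loopedLadder_ne fun h => hu (congrArg k h))

theorem outputs_of_correctCoBuchi_empty
    (h : M.CorrectCoBuchi (loopedLadder D ∅) 0 {v | Even v.val}) :
    M.Outputs (loopedLadder D ∅) false := by
  obtain ⟨b, hb, hiff⟩ := h
  cases b
  · exact hb
  · exact absurd (hiff.1 rfl) (not_coBuchi_loopedLadder_empty 0)

theorem outputs_of_correctCoBuchi_singleton {t : Fin (D + 1)} (ht : Even t.val)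
    (h : M.CorrectCoBuchi (loopedLadder D {t}) 0 {v | Even v.val}) :
    M.Outputs (loopedLadder D {t}) true := by
  obtain ⟨b, hb, hiff⟩ := h
  have hT : t ∈ {v : Fin (D + 1) | Even v.val} := ht
  rwa [hiff.2 (coBuchi_loopedLadder_singleton hT)] at hb

/-- A machine that rejects the loop-free graph performs on it at least one operation for each
vertex whose loop makes it accept. -/
theorem card_le_oneStepOps {A : Finset (Fin (D + 1))} (h0 : M.Outputs (loopedLadder D ∅) false)
    (hA : ∀ t ∈ A, M.Outputs (loopedLadder D {t}) true) :
    (A.card : ℕ∞) ≤ M.oneStepOps (loopedLadder D ∅) := by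
  obtain ⟨τ, hτ⟩ := h0
  have hprobe : ∀ t ∈ A, ∃ i < τ, M.step (loopedLadder D ∅) (M.run (loopedLadder D ∅) i) ≠
      M.step (loopedLadder D {t}) (M.run (loopedLadder D ∅) i) := by
    intro t ht
    by_contra! hall
    -- If no step before τ notices the loop at t, the rejection carries over to the graph that must
    -- be accepted.
    rw [run_eq_of_step_eq hall] at hτ
    exact Bool.false_ne_true (Outputs.unique ⟨τ, hτ⟩ (hA t ht))
  choose! f hf hne using hprobe
  have hcard : A.card ≤ ∑ i ∈ Finset.range τ, M.stepCost (M.run (loopedLadder D ∅) i) := by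
    have hinj : Set.InjOn f A := by
      intro t ht u hu htu
      have hu' := hne u hu
      rw [← htu] at hu'
      exact eq_of_step_loopedLadder_ne (hne t ht) hu'
    calc A.card = ∑ i ∈ A.image f, 1 := by
          rw [Finset.sum_const, smul_eq_mul, mul_one, Finset.card_image_of_injOn hinj]
      _ = ∑ i ∈ A.image f, M.stepCost (M.run (loopedLadder D ∅) i) := by
          refine Finset.sum_congr rfl fun i hi => ?_
          obtain ⟨t, ht, rfl⟩ := Finset.mem_image.1 hi
          exact (stepCost_eq_one_of_step_loopedLadder_ne (hne t ht)).symm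
      _ ≤ _ := Finset.sum_le_sum_of_subset (Finset.image_subset_iff.2 fun t ht =>
          Finset.mem_range.2 (hf t ht))
  exact le_trans (by exact_mod_cast hcard) (le_iSup (fun t : ℕ =>
    ((∑ i ∈ Finset.range t, M.stepCost (M.run (loopedLadder D ∅) i) : ℕ) : ℕ∞)) τ)

end SymbolicMachine

/-! ### Counting the even vertices -/

/-- The even elements of `Fin (D + 1)`. -/
def evenVertices (D : ℕ) : Finset (Fin (D + 1)) := Finset.univ.filter fun v => Even v.val

theorem le_two_mul_card_evenVertices (D : ℕ) : D ≤ 2 * (evenVertices D).card := by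
  have h : (Finset.univ : Finset (Fin (D / 2 + 1))).card ≤ (evenVertices D).card := by
    refine Finset.card_le_card_of_injOn
      (fun k => (⟨2 * k.val, by have := k.isLt; omega⟩ : Fin (D + 1))) (fun k _ => ?_) ?_
    · simp [evenVertices]
    · intro k _ l _ hkl
      have := congrArg Fin.val hkl
      exact Fin.ext (by simp only at this; omega)
  rw [Finset.card_univ, Fintype.card_fin] at h
  omega

theorem half_mul_le_mul_card_evenVertices (q : ℝ≥0) (D : ℕ) :
    ((q / 2 : ℝ≥0) : ℝ≥0∞) * D ≤ q * ((evenVertices D).card : ℝ≥0∞) := by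
  have h : (D : ℝ≥0) ≤ 2 * (evenVertices D).card := by
    exact_mod_cast le_two_mul_card_evenVertices D
  have h' : q / 2 * D ≤ q * (evenVertices D).card := by
    calc q / 2 * D ≤ q / 2 * (2 * (evenVertices D).card) := by gcongr
      _ = _ := by field_simp
  exact_mod_cast h'

/-! ### The randomized bound -/

namespace RandomizedSymbolicAlgorithm

open MeasureTheory Digraph

variable (A : RandomizedSymbolicAlgorithm)

/-- Each of the two answers fails with probability at most ε; inclusion–exclusion bounds the joint
success. -/
theorem ofReal_le_measure_outputs_inter {ε : ℝ} {D : ℕ} (hε' : ε < 1 / 2)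
    (hA : A.SolvesCoBuchi ε D) {t : Fin (D + 1)} (ht : Even t.val) :
    ENNReal.ofReal (1 - 2 * ε) ≤ A.μ
      ({ω | ((A.alg ω).machine (D + 1) 0 {v | Even v.val}).Outputs (loopedLadder D ∅) false} ∩
       {ω | ((A.alg ω).machine (D + 1) 0 {v | Even v.val}).Outputs (loopedLadder D {t}) true}) := by
  let _ := A.mΩ
  have := A.isProb
  set E := {ω | ((A.alg ω).machine (D + 1) 0 {v | Even v.val}).Outputs (loopedLadder D ∅) false}
  set F := {ω | ((A.alg ω).machine (D + 1) 0 {v | Even v.val}).Outputs (loopedLadder D {t}) true}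
  have hF : MeasurableSet F := A.measurableSet_outputs _ _ _ _ _
  have h1 : ENNReal.ofReal (1 - ε) ≤ A.μ E :=
    (hA _ _ 0 _ (diameter_loopedLadder D ∅)).trans
      (measure_mono fun ω h => SymbolicMachine.outputs_of_correctCoBuchi_empty h)
  have h2 : ENNReal.ofReal (1 - ε) ≤ A.μ F :=
    (hA _ _ 0 _ (diameter_loopedLadder D {t})).trans
      (measure_mono fun ω h => SymbolicMachine.outputs_of_correctCoBuchi_singleton ht h)
  have h3 : A.μ (E ∪ F) + A.μ (E ∩ F) = A.μ E + A.μ F := measure_union_add_inter E hF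
  have h4 : ENNReal.ofReal (1 - ε) + ENNReal.ofReal (1 - ε) ≤ 1 + A.μ (E ∩ F) := by
    calc _ ≤ A.μ E + A.μ F := add_le_add h1 h2
      _ = A.μ (E ∪ F) + A.μ (E ∩ F) := h3.symm
      _ ≤ _ := by gcongr; exact prob_le_one
  have h5 : ENNReal.ofReal (1 - ε) + ENNReal.ofReal (1 - ε) = 1 + ENNReal.ofReal (1 - 2 * ε) := by
    rw [← ENNReal.ofReal_one, ← ENNReal.ofReal_add (by linarith) (by linarith),
      ← ENNReal.ofReal_add (by linarith) (by linarith)]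
    congr 1
    ring
  rw [h5] at h4
  exact (ENNReal.add_le_add_iff_left ENNReal.one_ne_top).1 h4

theorem mul_card_evenVertices_le_expectedOneStepOps {ε : ℝ} {D : ℕ}
    (hε' : ε < 1 / 2) (hA : A.SolvesCoBuchi ε D) :
    ENNReal.ofReal (1 - 2 * ε) * ((evenVertices D).card : ℝ≥0∞) ≤
      A.expectedOneStepOps (loopedLadder D ∅) 0 {v | Even v.val} := by
  classical
  let _ := A.mΩ
  let B (t : Fin (D + 1)) : Set A.Ω :=
    {ω | ((A.alg ω).machine (D + 1) 0 {v | Even v.val}).Outputs (loopedLadder D ∅) false} ∩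
    {ω | ((A.alg ω).machine (D + 1) 0 {v | Even v.val}).Outputs (loopedLadder D {t}) true}
  have hB (t : Fin (D + 1)) : MeasurableSet (B t) :=
    (A.measurableSet_outputs _ _ _ _ _).inter (A.measurableSet_outputs _ _ _ _ _)
  have hpt (ω : A.Ω) : ∑ t ∈ evenVertices D, (B t).indicator (1 : A.Ω → ℝ≥0∞) ω ≤
      (((A.alg ω).machine (D + 1) 0 {v | Even v.val}).oneStepOps (loopedLadder D ∅) : ℝ≥0∞) := by
    have hsum : ∑ t ∈ evenVertices D, (B t).indicator (1 : A.Ω → ℝ≥0∞) ω =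
        (((evenVertices D).filter fun t => ω ∈ B t).card : ℝ≥0∞) := by
      simp only [Set.indicator_apply, Pi.one_apply]
      exact Finset.sum_boole _ _
    rw [hsum]
    -- Rejection of the loop-free graph is part of `B t`, so it is available only if some t
    -- qualifies; otherwise the bound is 0.
    rcases ((evenVertices D).filter fun t => ω ∈ B t).eq_empty_or_nonempty with h | ⟨t, ht⟩
    · simp [h]
    · have := SymbolicMachine.card_le_oneStepOps (A := (evenVertices D).filter fun t => ω ∈ B t)
        (Finset.mem_filter.1 ht).2.1 fun u hu => (Finset.mem_filter.1 hu).2.2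
      exact_mod_cast ENat.toENNReal_le.2 this
  calc ENNReal.ofReal (1 - 2 * ε) * ((evenVertices D).card : ℝ≥0∞)
      = ∑ t ∈ evenVertices D, ENNReal.ofReal (1 - 2 * ε) := by
        rw [Finset.sum_const, nsmul_eq_mul, mul_comm]
    _ ≤ ∑ t ∈ evenVertices D, A.μ (B t) := Finset.sum_le_sum fun t ht =>
        A.ofReal_le_measure_outputs_inter hε' hA (Finset.mem_filter.1 ht).2
    _ = ∫⁻ ω, ∑ t ∈ evenVertices D, (B t).indicator (1 : A.Ω → ℝ≥0∞) ω ∂A.μ := by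
        rw [lintegral_finsetSum _ fun t _ => measurable_one.indicator (hB t)]
        exact Finset.sum_congr rfl fun t _ => (lintegral_indicator_one (hB t)).symm
    _ ≤ _ := lintegral_mono hpt

end RandomizedSymbolicAlgorithm

theorem proposition3p7 :
    -- deterministic algorithms
    (∃ c : ℝ≥0, 0 < c ∧ ∀ (D : ℕ) (A : SymbolicAlgorithm), A.SolvesCoBuchi D →
      ∃ (n : ℕ) (G : Digraph (Fin n)) (s : Fin n) (T : Set (Fin n)),
        G.diameter = D ∧
        (c : ℝ≥0∞) * (D : ℝ≥0∞) ≤ ((A.machine n s T).oneStepOps G : ℝ≥0∞)) ∧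
    -- randomized algorithms with error probability at most `ε < 1 / 2`
    (∀ ε : ℝ, 0 ≤ ε → ε < 1 / 2 → ∃ c : ℝ≥0, 0 < c ∧
      ∀ (D : ℕ) (A : RandomizedSymbolicAlgorithm), A.SolvesCoBuchi ε D →
      ∃ (n : ℕ) (G : Digraph (Fin n)) (s : Fin n) (T : Set (Fin n)),
        G.diameter = D ∧
        (c : ℝ≥0∞) * (D : ℝ≥0∞) ≤ A.expectedOneStepOps G s T) := by
  refine ⟨⟨1 / 2, by positivity, fun D A hA => ?_⟩, fun ε _ hε' => ?_⟩
  · refine ⟨D + 1, Digraph.loopedLadder D ∅, 0, {v | Even v.val},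
      Digraph.diameter_loopedLadder D ∅, (half_mul_le_mul_card_evenVertices 1 D).trans ?_⟩
    have h := SymbolicMachine.card_le_oneStepOps (A := evenVertices D)
      (SymbolicMachine.outputs_of_correctCoBuchi_empty
        (hA _ _ 0 _ (Digraph.diameter_loopedLadder D ∅)))
      fun t ht => SymbolicMachine.outputs_of_correctCoBuchi_singleton (Finset.mem_filter.1 ht).2
        (hA _ _ 0 _ (Digraph.diameter_loopedLadder D {t}))
    rw [ENNReal.coe_one, one_mul]
    exact_mod_cast ENat.toENNReal_le.2 h
  · refine ⟨Real.toNNReal (1 - 2 * ε) / 2,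
      div_pos (Real.toNNReal_pos.2 (by linarith)) two_pos, fun D A hA => ?_⟩
    exact ⟨D + 1, Digraph.loopedLadder D ∅, 0, {v | Even v.val},
      Digraph.diameter_loopedLadder D ∅, (half_mul_le_mul_card_evenVertices _ D).trans
        (A.mul_card_evenVertices_le_expectedOneStepOps hε' hA)⟩
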